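/- **Probabilistic zero forcing.** Let $G$ be a finite graph and $Z\subseteq V(G)$ a set of initially blue vertices; all other vertices are white. In each round, with $B$ the current set of blue vertices, every blue vertex $u$ attempts to force each of its white neighbors $w$, all attempts being independent, and each attempt succeeds with probability $$\frac{|N[u]\cap B|}{\deg(u)},$$ where $N[u]$ is the closed neighborhood of $u$. A white vertex becomes blue at the end of the round if at least one attempt to force it succeeds, and blue vertices stay blue. The propagation time $pt_{pzf}(G,v)$ is the (random) first number $t\ge 0$ of rounds after which all vertices are blue when the process starts from $Z=\{v\}$ ($\infty$ if this never happens). The propagation time of the graph is $pt_{pzf}(G)=\min_{v\in V(G)}pt_{pzf}(G,v)$, where the $|V(G)|$ runs of the process, one for each starting vertex $v$, are performed independently on the same graph $G$. Let $\mathcal G(n,p)$ be the binomial random graph on $n$ labelled vertices, in which each pair of vertices is an edge independently with probability $p$. Probabilities below are over both the random graph and the forcing process on it. **Theorem.** Let $p=p(n)\in[0,1]$ satisfy $p(n)\ge 1/\log^2 n$ for all sufficiently large $n$ (natural logarithm). Then there is a sequence $\delta(n)\to 0$ such that: 1. for every vertex $v$ of $\mathcal G(n,p)$, with probability $1-o(n^{-1})$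 (where the $o(n^{-1})$ is uniform in $v$), $$pt_{pzf}(\mathcal G(n,p),v)\ \ge\ (1+\delta(n))\log_2\log_2 n;$$ 2. with probability tending to $1$ as $n\to\infty$, $$pt_{pzf}(\mathcal G(n,p))\ =\ \min_{v}\,pt_{pzf}(\mathcal G(n,p),v)\ \ge\ (1+\delta(n))\log_2\log_2 n.$$ -/

import Mathlib

open MeasureTheory ProbabilityTheory Filter Topology

namespace ProbZeroForcing

/-- The probability `|N[u] ∩ Z| / deg(u)` with which a blue vertex `u` forces any given one of its
white neighbors in a single round, when `Z` is the current set of blue vertices. (On a finite graph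
it is at most `1` as soon as `u` has a white neighbor.) -/
noncomputable def forceProb {V : Type*} (G : SimpleGraph V) (Z : Set V) (u : V) : ℝ :=
  ((insert u (G.neighborSet u) ∩ Z).ncard : ℝ) / ((G.neighborSet u).ncard : ℝ)

/-- The blue set after one round played from the blue set `Z`. The number `U (u, w) ∈ [0,1]` is the
randomness of the attempt of `u` to force `w`: a blue vertex `u` forces its white neighbor `w` if
and only if `U (u, w) ≤ |N[u] ∩ Z| / deg(u)`. -/
def step {V : Type*} (G : SimpleGraph V) (Z : Set V) (U : V × V → unitInterval) : Set V :=
  Z ∪ {w | ∃ u ∈ Z, G.Adj u w ∧ (U (u, w) : ℝ) ≤ forceProb G Z u}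

/-- The set of blue vertices after `t` rounds, starting from the blue set `Z`; round `t + 1` uses
the numbers `U t`. -/
def blue {V : Type*} (G : SimpleGraph V) (Z : Set V) (U : ℕ → V × V → unitInterval) : ℕ → Set V
  | 0 => Z
  | t + 1 => step G (blue G Z U t) (U t)

/-- The propagation time: the first round after which every vertex is blue (`⊤` if there is no such
round). -/
noncomputable def propTime {V : Type*} (G : SimpleGraph V) (Z : Set V)
    (U : ℕ → V × V → unitInterval) : ℕ∞ :=
  ⨅ (t : ℕ) (_ : blue G Z U t = Set.univ), (t : ℕ∞)

/-- The propagation time of the graph: the minimum, over all vertices `v`, of the propagation times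
of the runs started from `{v}`, where the run started from `{v}` uses its own numbers `W v`. -/
noncomputable def graphPropTime {V : Type*} (G : SimpleGraph V)
    (W : V → ℕ → V × V → unitInterval) : ℕ∞ :=
  ⨅ v : V, propTime G {v} (W v)

/-- The law of the randomness of one run: independent uniform numbers in `[0,1]`, one for each round
and each ordered pair of vertices. -/
noncomputable def runMeasure (V : Type*) [Fintype V] : Measure (ℕ → V × V → unitInterval) :=
  Measure.infinitePi fun _ : ℕ => Measure.pi fun _ : V × V => (volume : Measure unitInterval)

/-- The law of the random graph `G(n,p)` together with an independent run: first the graph is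
drawn, then probabilistic zero forcing is run once on it. -/
noncomputable def oneRunMeasure (n : ℕ) (p : unitInterval) :
    Measure (SimpleGraph (Fin n) × (ℕ → Fin n × Fin n → unitInterval)) :=
  (SimpleGraph.binomialRandom (Fin n) p).prod (runMeasure (Fin n))

/-- The law of the random graph `G(n,p)` together with `n` mutually independent runs on that graph,
one for each vertex. -/
noncomputable def allRunsMeasure (n : ℕ) (p : unitInterval) :
    Measure (SimpleGraph (Fin n) × (Fin n → ℕ → Fin n × Fin n → unitInterval)) :=
  (SimpleGraph.binomialRandom (Fin n) p).prod (Measure.pi fun _ : Fin n => runMeasure (Fin n))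

end ProbZeroForcing

namespace ProbZeroForcing

variable {V : Type*}

/-! The bound holds on every fixed graph: starting from one vertex, the number of blue vertices at
most roughly squares in each round. A blue vertex `u` makes at most `deg(u)` attempts, each
succeeding with probability at most `|N[u] ∩ B| / deg(u)`, so it expects at most `|B|` successes,
and a round expects at most `|B|^2`. The attempts are independent, so an exponential moment with
base 2 and Markov's inequality give more than `|B| + 2|B|^2 + s` blue vertices with probability at
most `2^{-s}` (`roundMeasure_lt_ncard_step_le`).

Iterating, `4|B|` stays below `(4s)^(2^t)` outside an event of probability `t 2^{-s}`
(`runMeasure_lt_ncard_blue_le`). With `L = log₂ log₂ n`, `s` of order `log n` and `t = ⌊L - √L⌋`,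
this bound is at most `n`, so some vertex is still white, with failure probability at most `n^{-2}`.
A union bound over the starting vertices costs a factor `n`. Averaging over the graph preserves both
bounds. -/

/-! ### One round: tail bound for the number of successes. -/

theorem forceProb_nonneg (G : SimpleGraph V) (Z : Set V) (u : V) : 0 ≤ forceProb G Z u := by
  unfold forceProb
  positivity

/-- The expected number of successful attempts of `u` is at most the number of blue vertices. -/
theorem degree_mul_forceProb_le [Finite V] (G : SimpleGraph V) (Z : Set V) (u : V) :
    ((G.neighborSet u).ncard : ℝ) * forceProb G Z u ≤ Z.ncard := by
  unfold forceProb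
  have h : ((insert u (G.neighborSet u) ∩ Z).ncard : ℝ) ≤ Z.ncard := by
    exact_mod_cast Set.ncard_le_ncard Set.inter_subset_right (Set.toFinite _)
  rcases eq_or_ne ((G.neighborSet u).ncard : ℝ) 0 with h0 | h0
  -- An isolated vertex: division by zero gives 0.
  · simp [h0]
  · rwa [mul_div_cancel₀ _ h0]

theorem volume_real_le_of_nonneg {c : ℝ} (hc : 0 ≤ c) :
    (volume : Measure unitInterval).real {x | (x : ℝ) ≤ c} ≤ c := by
  rcases le_total 1 c with h | h
  · exact measureReal_le_one.trans h
  · have : {x : unitInterval | (x : ℝ) ≤ c} = Set.Iic ⟨c, hc, h⟩ := by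
      ext x
      simp [← Subtype.coe_le_coe]
    rw [this, measureReal_def, unitInterval.volume_Iic, ENNReal.toReal_ofReal hc]

open scoped Classical in
/-- The successful attempts made in a round by blue vertices. -/
noncomputable def successes [Fintype V] (G : SimpleGraph V) (Z : Set V)
    (U : V × V → unitInterval) : Finset (V × V) :=
  {e | (e.1 ∈ Z ∧ G.Adj e.1 e.2) ∧ (U e : ℝ) ≤ forceProb G Z e.1}

theorem ncard_step_le [Fintype V] (G : SimpleGraph V) (Z : Set V) (U : V × V → unitInterval) :
    (step G Z U).ncard ≤ Z.ncard + (successes G Z U).card := by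
  classical
  have hsub : step G Z U ⊆ Z ∪ ((successes G Z U).image Prod.snd : Finset V) := by
    rintro w (hw | ⟨u, hu, huw, hU⟩)
    · exact Or.inl hw
    · refine Or.inr ?_
      simp only [Finset.coe_image, Set.mem_image, Finset.mem_coe]
      exact ⟨(u, w), by simp [successes, hu, huw, hU], rfl⟩
  refine (Set.ncard_le_ncard hsub (Set.toFinite _)).trans ((Set.ncard_union_le _ _).trans ?_)
  rw [Set.ncard_coe_finset]
  gcongr
  exact Finset.card_image_le

theorem sum_forceProb_le [Fintype V] (G : SimpleGraph V) (Z : Set V)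
    [DecidablePred fun e : V × V => e.1 ∈ Z ∧ G.Adj e.1 e.2] :
    ∑ e : V × V, (if e.1 ∈ Z ∧ G.Adj e.1 e.2 then forceProb G Z e.1 else 0)
      ≤ (Z.ncard : ℝ) ^ 2 := by
  classical
  calc ∑ e : V × V, (if e.1 ∈ Z ∧ G.Adj e.1 e.2 then forceProb G Z e.1 else 0)
      = ∑ u : V, if u ∈ Z then ((G.neighborSet u).ncard : ℝ) * forceProb G Z u else 0 := by
        rw [Fintype.sum_prod_type]
        refine Finset.sum_congr rfl fun u _ => ?_
        by_cases hu : u ∈ Z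
        · have : (G.neighborSet u).ncard = (Finset.univ.filter fun w => G.Adj u w).card := by
            rw [← Set.ncard_coe_finset]
            congr 1
            ext w
            simp
          simp only [hu, true_and, if_true, this]
          rw [← Finset.sum_filter, Finset.sum_const, nsmul_eq_mul]
        · simp [hu]
    _ ≤ ∑ u : V, if u ∈ Z then (Z.ncard : ℝ) else 0 := by
        refine Finset.sum_le_sum fun u _ => ?_
        split_ifs
        · exact degree_mul_forceProb_le G Z u
        · exact le_rfl
    _ = (Z.ncard : ℝ) ^ 2 := by
        rw [← Finset.sum_filter, Finset.sum_const, nsmul_eq_mul, sq]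
        congr 2
        rw [← Set.ncard_coe_finset]
        congr 1
        ext w
        simp

/-- The law of the randomness of one round. -/
noncomputable abbrev roundMeasure (V : Type*) [Fintype V] : Measure (V × V → unitInterval) :=
  Measure.pi fun _ : V × V => (volume : Measure unitInterval)

theorem measurableSet_le_const (c : ℝ) : MeasurableSet {x : unitInterval | (x : ℝ) ≤ c} :=
  measurableSet_le measurable_subtype_coe measurable_const

open scoped Classical in
theorem two_pow_card_successes [Fintype V] (G : SimpleGraph V) (Z : Set V)
    (U : V × V → unitInterval) :
    (2 : ℝ) ^ (successes G Z U).card = ∏ e : V × V, if (e.1 ∈ Z ∧ G.Adj e.1 e.2) ∧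
      (U e : ℝ) ≤ forceProb G Z e.1 then (2 : ℝ) else 1 := by
  rw [← Finset.prod_filter, Finset.prod_const]
  simp only [successes]

open scoped Classical in
theorem integrable_factor [Fintype V] (G : SimpleGraph V) (Z : Set V) (e : V × V) :
    Integrable (fun x : unitInterval => if (e.1 ∈ Z ∧ G.Adj e.1 e.2) ∧
      (x : ℝ) ≤ forceProb G Z e.1 then (2 : ℝ) else 1) := by
  refine Integrable.of_bound (C := 2) ?_ (ae_of_all _ fun x => ?_)
  · refine (Measurable.ite ?_ measurable_const measurable_const).aestronglyMeasurable
    exact (MeasurableSet.const _).inter (measurableSet_le_const _)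
  · split_ifs <;> norm_num

theorem integrable_two_pow_card_successes [Fintype V] (G : SimpleGraph V) (Z : Set V) :
    Integrable (fun U => (2 : ℝ) ^ (successes G Z U).card) (roundMeasure V) := by
  simp_rw [two_pow_card_successes]
  exact Integrable.fintype_prod (integrable_factor G Z)

/-- By independence the moment factors over the attempts. An attempt with success probability at
most `q` contributes at most `1 + q ≤ exp q`, and the `q` sum to at most `|Z|^2`. -/
theorem integral_two_pow_card_successes_le [Fintype V] (G : SimpleGraph V) (Z : Set V) :
    ∫ U, (2 : ℝ) ^ (successes G Z U).card ∂roundMeasure V ≤ Real.exp ((Z.ncard : ℝ) ^ 2) := by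
  classical
  simp_rw [two_pow_card_successes]
  rw [integral_fintype_prod_eq_prod (𝕜 := ℝ) (fun (e : V × V) (x : unitInterval) =>
    if (e.1 ∈ Z ∧ G.Adj e.1 e.2) ∧ (x : ℝ) ≤ forceProb G Z e.1 then (2 : ℝ) else 1)]
  refine le_trans ?_ (Real.exp_le_exp.2 (sum_forceProb_le G Z))
  rw [Real.exp_sum]
  refine Finset.prod_le_prod (fun e _ => integral_nonneg fun x => by positivity) fun e _ => ?_
  by_cases he : e.1 ∈ Z ∧ G.Adj e.1 e.2
  · simp only [he, true_and, if_true]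
    have h1 : (fun x : unitInterval => if (x : ℝ) ≤ forceProb G Z e.1 then (2 : ℝ) else 1) =
        fun x => 1 + Set.indicator {x : unitInterval | (x : ℝ) ≤ forceProb G Z e.1} 1 x := by
      ext x
      simp only [Set.indicator_apply, Set.mem_ofPred_eq, Pi.one_apply]
      split_ifs <;> norm_num
    rw [h1, integral_add (integrable_const _)
      ((integrable_indicator_iff (measurableSet_le_const _)).2 (integrable_const _).integrableOn),
      integral_indicator_one (measurableSet_le_const _)]
    have h2 := volume_real_le_of_nonneg (forceProb_nonneg G Z e.1)
    have h3 := Real.add_one_le_exp (forceProb G Z e.1)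
    simp only [integral_const, probReal_univ, smul_eq_mul, mul_one]
    linarith
  · simp only [he, false_and, if_false]
    simp

theorem roundMeasure_real_card_successes_le [Fintype V] (G : SimpleGraph V) (Z : Set V) (s : ℕ) :
    (roundMeasure V).real {U | 2 * Z.ncard ^ 2 + s ≤ (successes G Z U).card} ≤ (2 ^ s)⁻¹ := by
  have h := mul_meas_ge_le_integral_of_nonneg (μ := roundMeasure V)
    (ae_of_all _ fun U => by positivity) (integrable_two_pow_card_successes G Z)
    (2 ^ (2 * Z.ncard ^ 2 + s))
  have hset : {U | (2 : ℝ) ^ (2 * Z.ncard ^ 2 + s) ≤ 2 ^ (successes G Z U).card} =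
      {U | 2 * Z.ncard ^ 2 + s ≤ (successes G Z U).card} := by
    ext U
    exact pow_le_pow_iff_right₀ (one_lt_two : (1 : ℝ) < 2)
  rw [hset] at h
  replace h := h.trans (integral_two_pow_card_successes_le G Z)
  -- The coefficient 2 of `|Z|^2` comes from `e ≤ 2^2`; after cancellation only `2^s` remains.
  have hexp : Real.exp ((Z.ncard : ℝ) ^ 2) ≤ 2 ^ (2 * Z.ncard ^ 2) := by
    have h1 : Real.exp ((Z.ncard : ℝ) ^ 2) = Real.exp 1 ^ (Z.ncard ^ 2) := by
      rw [← Real.exp_nat_mul]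
      push_cast
      ring_nf
    rw [h1, pow_mul]
    exact pow_le_pow_left₀ (Real.exp_pos _).le (by linarith [Real.exp_one_lt_d9]) _
  rw [pow_add, mul_assoc] at h
  have h4 := le_of_mul_le_mul_left ((h.trans hexp).trans (mul_one _).ge)
    (by positivity : (0 : ℝ) < 2 ^ (2 * Z.ncard ^ 2))
  rw [← one_div]
  rwa [le_div_iff₀' (by positivity)]

theorem roundMeasure_lt_ncard_step_le [Fintype V] (G : SimpleGraph V) (Z : Set V) (s : ℕ) :
    roundMeasure V {U | Z.ncard + 2 * Z.ncard ^ 2 + s < (step G Z U).ncard} ≤ (2 ^ s)⁻¹ := by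
  have h : roundMeasure V {U | 2 * Z.ncard ^ 2 + s ≤ (successes G Z U).card} ≤ (2 ^ s)⁻¹ := by
    have := ENNReal.ofReal_le_ofReal (roundMeasure_real_card_successes_le G Z s)
    rwa [ofReal_measureReal, ENNReal.ofReal_inv_of_pos (by positivity),
      ENNReal.ofReal_pow (by norm_num), ENNReal.ofReal_ofNat] at this
  refine (measure_mono fun U hU => ?_).trans h
  have := ncard_step_le G Z U
  simp only [Set.mem_ofPred_eq] at hU ⊢
  omega

/-! ### The blue set as a process: monotonicity, measurability, independence of the next round. -/

theorem blue_subset_succ (G : SimpleGraph V) (Z : Set V) (U : ℕ → V × V → unitInterval) (t : ℕ) :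
    blue G Z U t ⊆ blue G Z U (t + 1) :=
  Set.subset_union_left

theorem blue_mono (G : SimpleGraph V) (Z : Set V) (U : ℕ → V × V → unitInterval) :
    Monotone (blue G Z U) :=
  monotone_nat_of_le_succ (blue_subset_succ G Z U)

theorem blue_congr (G : SimpleGraph V) (Z : Set V) {U U' : ℕ → V × V → unitInterval} {t : ℕ}
    (h : ∀ i < t, U i = U' i) : blue G Z U t = blue G Z U' t := by
  induction t with
  | zero => rfl
  | succ t ih =>
    simp only [blue]
    rw [ih fun i hi => h i (hi.trans t.lt_succ_self), h t t.lt_succ_self]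

theorem lt_propTime (G : SimpleGraph V) (Z : Set V) (U : ℕ → V × V → unitInterval) {t : ℕ}
    (h : blue G Z U t ≠ Set.univ) : ((t + 1 : ℕ) : ℕ∞) ≤ propTime G Z U := by
  refine le_iInf₂ fun k hk => ?_
  by_contra! hlt
  have hkt : k ≤ t := by
    have : k < t + 1 := by exact_mod_cast hlt
    omega
  exact h (Set.univ_subset_iff.1 (hk ▸ blue_mono G Z U hkt))

theorem measurableSet_step_eq [Finite V] (G : SimpleGraph V) (Z Y : Set V) :
    MeasurableSet {U : V × V → unitInterval | step G Z U = Y} := by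
  have : {U : V × V → unitInterval | step G Z U = Y} =
      ⋂ w : V, {U | w ∈ step G Z U ↔ w ∈ Y} := by
    ext U
    simp [Set.ext_iff]
  rw [this]
  refine MeasurableSet.iInter fun w => ?_
  have hw : MeasurableSet {U : V × V → unitInterval | w ∈ step G Z U} := by
    have : {U : V × V → unitInterval | w ∈ step G Z U} = {_U | w ∈ Z} ∪
        ⋃ u : V, {_U | u ∈ Z ∧ G.Adj u w} ∩ {U | (U (u, w) : ℝ) ≤ forceProb G Z u} := by
      ext U
      simp [step, and_assoc]
    rw [this]
    refine (MeasurableSet.const _).union (MeasurableSet.iUnion fun u => ?_)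
    exact (MeasurableSet.const _).inter
      (measurableSet_le_const (forceProb G Z u) |>.preimage (measurable_pi_apply (u, w)))
  by_cases hY : w ∈ Y
  · simp only [hY, iff_true]
    exact hw
  · simp only [hY, iff_false]
    exact hw.compl

theorem measurableSet_blue_eq [Finite V] (G : SimpleGraph V) (Z Y : Set V) (t : ℕ) :
    MeasurableSet {U : ℕ → V × V → unitInterval | blue G Z U t = Y} := by
  induction t generalizing Y with
  | zero => exact MeasurableSet.const (Z = Y)
  | succ t ih =>
    have : {U : ℕ → V × V → unitInterval | blue G Z U (t + 1) = Y} =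
        ⋃ X : Set V, {U | blue G Z U t = X} ∩ {U | step G X (U t) = Y} := by
      ext U
      simp [blue]
    rw [this]
    exact MeasurableSet.iUnion fun X =>
      (ih X).inter ((measurableSet_step_eq G X Y).preimage (measurable_pi_apply t))

instance [Fintype V] : IsProbabilityMeasure (runMeasure V) := by
  unfold runMeasure
  infer_instance

/-- The numbers of round `t + 1` are independent of the blue set after `t` rounds. -/
theorem runMeasure_blue_eq_inter [Fintype V] (G : SimpleGraph V) (Z Y : Set V) (t : ℕ)
    {D : Set (V × V → unitInterval)} (hD : MeasurableSet D) :
    runMeasure V ({U | blue G Z U t = Y} ∩ {U | U t ∈ D}) =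
      runMeasure V {U | blue G Z U t = Y} * roundMeasure V D := by
  classical
  have hind : iIndepFun (fun i (U : ℕ → V × V → unitInterval) => U i) (runMeasure V) :=
    iIndepFun_infinitePi (X := fun _ ω => ω) fun _ => measurable_id
  have h2 := hind.indepFun_finset (Finset.range t) {t} (by simp) fun i => measurable_pi_apply i
  -- Rounds from `t` on are filled with 0; the blue set after `t` rounds does not read them.
  let ext : (Finset.range t → V × V → unitInterval) → ℕ → V × V → unitInterval :=
    fun x i => if h : i ∈ Finset.range t then x ⟨i, h⟩ else 0
  have hext : Measurable ext := by
    refine measurable_pi_lambda _ fun i => ?_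
    by_cases h : i ∈ Finset.range t
    · simp only [ext, h, dif_pos]
      exact measurable_pi_apply _
    · simp only [ext, h, dif_neg, not_false_eq_true]
      exact measurable_const
  have key := h2.measure_inter_preimage_eq_mul (ext ⁻¹' {U | blue G Z U t = Y})
    ((fun x => x ⟨t, Finset.mem_singleton_self t⟩) ⁻¹' D)
    (hext (measurableSet_blue_eq G Z Y t)) (measurable_pi_apply _ hD)
  have e1 : (fun (U : ℕ → V × V → unitInterval) (i : Finset.range t) => U i) ⁻¹'
      (ext ⁻¹' {U | blue G Z U t = Y}) = {U | blue G Z U t = Y} := by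
    refine Set.ext fun U => ?_
    simp only [Set.mem_preimage, Set.mem_ofPred_eq]
    rw [blue_congr G Z (U := ext fun i => U i) (U' := U)]
    intro i hi
    simp [ext, hi]
  have e2 : (fun (U : ℕ → V × V → unitInterval) (i : ({t} : Finset ℕ)) => U i) ⁻¹'
      ((fun x => x ⟨t, Finset.mem_singleton_self t⟩) ⁻¹' D) = {U | U t ∈ D} := rfl
  rw [e1, e2] at key
  rw [key]
  congr 1
  exact (measurePreserving_eval_infinitePi
    (fun _ : ℕ => roundMeasure V) t).measure_preimage hD.nullMeasurableSet

/-! ### Iterating the one-round bound. -/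

/-- With high probability the logarithm of the number of blue vertices at most doubles
in each round, up to a correction of the base. -/
theorem runMeasure_lt_ncard_blue_le [Fintype V] (G : SimpleGraph V) (v : V) {s : ℕ} (hs : 1 ≤ s)
    (t : ℕ) :
    runMeasure V {U | (4 * s) ^ 2 ^ t < 4 * (blue G {v} U t).ncard} ≤ t * (2 ^ s)⁻¹ := by
  induction t with
  | zero =>
    have : {U : ℕ → V × V → unitInterval |
        (4 * s) ^ 2 ^ 0 < 4 * (blue G {v} U 0).ncard} = ∅ := by
      ext U
      simp only [blue, Set.ncard_singleton, Set.mem_ofPred_eq, Set.mem_empty_iff_false, iff_false,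
        pow_zero, pow_one]
      omega
    rw [this, measure_empty]
    exact zero_le
  | succ t ih =>
    let D : Set V → Set (V × V → unitInterval) :=
      fun Z => {U | Z.ncard + 2 * Z.ncard ^ 2 + s < (step G Z U).ncard}
    have hD (Z : Set V) : MeasurableSet (D Z) := by
      have : D Z = ⋃ Y ∈ {Y : Set V | Z.ncard + 2 * Z.ncard ^ 2 + s < Y.ncard},
          {U | step G Z U = Y} := by
        ext U
        simp [D]
      rw [this]
      exact MeasurableSet.biUnion (Set.to_countable _) fun Y _ => measurableSet_step_eq G Z Y
    -- The bad event of the next round, split by the current blue set so that the bound for a fixed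
    -- set applies to each piece.
    let B : Set (ℕ → V × V → unitInterval) :=
      ⋃ Z : Set V, {U | blue G {v} U t = Z} ∩ {U | U t ∈ D Z}
    have hB : runMeasure V B ≤ (2 ^ s)⁻¹ := by
      calc runMeasure V B
          ≤ ∑' Z : Set V, runMeasure V ({U | blue G {v} U t = Z} ∩ {U | U t ∈ D Z}) :=
            measure_iUnion_le _
        _ ≤ ∑' Z : Set V, runMeasure V {U | blue G {v} U t = Z} * (2 ^ s)⁻¹ := by
            refine ENNReal.tsum_le_tsum fun Z => ?_
            rw [runMeasure_blue_eq_inter G {v} Z t (hD Z)]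
            gcongr
            exact roundMeasure_lt_ncard_step_le G Z s
        _ = (2 ^ s)⁻¹ := by
            rw [ENNReal.tsum_mul_right, ← measure_iUnion _ fun Z => measurableSet_blue_eq G _ Z t]
            · have : ⋃ Z : Set V, {U : ℕ → V × V → unitInterval | blue G {v} U t = Z} =
                  Set.univ := by
                ext U
                simp
              rw [this, measure_univ, one_mul]
            · intro Z Z' hZ
              refine Set.disjoint_left.2 fun U hU hU' => hZ ?_
              exact Eq.trans (Eq.symm hU) hU'
    have hsub : {U : ℕ → V × V → unitInterval |
        (4 * s) ^ 2 ^ (t + 1) < 4 * (blue G {v} U (t + 1)).ncard} ⊆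
        {U | (4 * s) ^ 2 ^ t < 4 * (blue G {v} U t).ncard} ∪ B := by
      intro U hU
      by_contra hcon
      simp only [Set.mem_union, Set.mem_ofPred_eq, not_or, not_lt, B, Set.mem_iUnion,
        Set.mem_inter_iff, D, ↓existsAndEq, true_and] at hcon hU
      obtain ⟨h1, h2⟩ := hcon
      have h3 : 4 * s ≤ (4 * s) ^ 2 ^ t := Nat.le_self_pow (by positivity) _
      rw [pow_succ 2 t, pow_mul] at hU
      simp only [blue] at hU
      generalize (4 * s) ^ 2 ^ t = x at *
      generalize (blue G {v} U t).ncard = b at *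
      -- With `4b ≤ x`, `4s ≤ x` and `4 ≤ x`: `8b^2 ≤ x^2/2`, while `4b` and `4s` are each at most
      -- `x^2/4`, so `4(b + 2b^2 + s) ≤ x^2`. This is why the counts are scaled by 4.
      nlinarith [Nat.mul_le_mul h1 h1, Nat.mul_le_mul h1 (le_trans (by omega : 4 ≤ 4 * s) h3)]
    calc _ ≤ _ := measure_mono hsub
      _ ≤ t * (2 ^ s)⁻¹ + (2 ^ s)⁻¹ := (measure_union_le _ _).trans (add_le_add ih hB)
      _ = _ := by push_cast; ring

/-! ### From a fixed graph to the random graph. -/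

theorem measurableSingletonClass_simpleGraph [Countable V] :
    MeasurableSingletonClass (SimpleGraph V) where
  measurableSet_singleton G := by
    have : ({G} : Set (SimpleGraph V)) = ⋂ (u : V) (w : V), {H | H.Adj u w ↔ G.Adj u w} := by
      ext H
      simp [SimpleGraph.ext_iff, funext_iff]
    rw [this]
    refine MeasurableSet.iInter fun u => MeasurableSet.iInter fun w => ?_
    have h := measurableSet_setOfPred.2
      (SimpleGraph.measurable_iff_adj.1 (measurable_id (α := SimpleGraph V)) u w)
    by_cases huw : G.Adj u w
    · simp only [huw, iff_true]
      exact h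
    · simp only [huw, iff_false]
      exact h.compl

/-- A set all of whose sections over a finite space are small has small measure. -/
theorem prod_measure_le_of_forall_section {α β : Type*} [Finite α] [MeasurableSpace α]
    [MeasurableSingletonClass α] [MeasurableSpace β] (μ : Measure α) [IsProbabilityMeasure μ]
    (ν : Measure β) [SFinite ν] {S : Set (α × β)} {c : ENNReal}
    (h : ∀ a, ν {b | (a, b) ∈ S} ≤ c) : μ.prod ν S ≤ c := by
  classical
  have := Fintype.ofFinite α
  have hS : S ⊆ ⋃ a : α, {a} ×ˢ {b | (a, b) ∈ S} := by
    rintro ⟨a, b⟩ hab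
    simpa using hab
  calc μ.prod ν S ≤ ∑ a : α, μ {a} * ν {b | (a, b) ∈ S} :=
        (measure_mono hS).trans ((measure_iUnion_fintype_le _ _).trans
          (Finset.sum_le_sum fun a _ => Measure.prod_prod_le _ _))
    _ ≤ ∑ a : α, μ {a} * c := by gcongr with a; exact h a
    _ = c := by rw [← Finset.sum_mul, sum_measure_singleton]; simp

instance (n : ℕ) (p : unitInterval) : IsProbabilityMeasure (oneRunMeasure n p) := by
  unfold oneRunMeasure
  infer_instance

instance (n : ℕ) (p : unitInterval) : IsProbabilityMeasure (allRunsMeasure n p) := by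
  unfold allRunsMeasure
  infer_instance

/-- Subadditivity suffices, so the event need not be shown measurable. -/
theorem one_sub_le_measureReal_of_compl {α : Type*} [MeasurableSpace α] (μ : Measure α)
    [IsProbabilityMeasure μ] {S : Set α} {c : ℝ} (hc : 0 ≤ c) (h : μ Sᶜ ≤ ENNReal.ofReal c) :
    1 - c ≤ μ.real S := by
  have h1 : μ.real Sᶜ ≤ c := ENNReal.toReal_le_of_le_ofReal hc h
  have h2 : μ.real (S ∪ Sᶜ) ≤ μ.real S + μ.real Sᶜ := measureReal_union_le _ _
  rw [Set.union_compl_self, probReal_univ] at h2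
  linarith

/-! ### Choice of the number of rounds and of the slack. -/

/-- The leading term `log₂ log₂ n`. -/
noncomputable def doubleLog (n : ℕ) : ℝ := Real.logb 2 (Real.logb 2 (n : ℝ))

/-- A number of rounds, asymptotic to `log₂ log₂ n`, that does not suffice with high probability. -/
noncomputable def roundCount (n : ℕ) : ℕ := ⌊doubleLog n - √(doubleLog n)⌋₊

/-- The slack in the exponent of the one-round tail bound. -/
def slack (n : ℕ) : ℕ := 3 * (Nat.log 2 n + 1)

/-- The size conditions on `n` that the estimates need. -/
structure IsLarge (n : ℕ) : Prop where
  two_le : 2 ≤ n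
  one_le_doubleLog : 1 ≤ doubleLog n
  doubleLog_le : doubleLog n ≤ n
  add_le_rpow : 5 + doubleLog n ≤ 2 ^ √(doubleLog n)

theorem tendsto_doubleLog : Tendsto doubleLog atTop atTop :=
  (Real.tendsto_logb_atTop one_lt_two).comp
    ((Real.tendsto_logb_atTop one_lt_two).comp tendsto_natCast_atTop_atTop)

theorem logb_two_le_self {x : ℝ} (hx : 1 ≤ x) : Real.logb 2 x ≤ x := by
  rw [Real.logb_le_iff_le_rpow one_lt_two (by linarith)]
  calc x ≤ (⌊x⌋₊ : ℝ) + 1 := (Nat.lt_floor_add_one x).le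
    _ ≤ 2 ^ ⌊x⌋₊ := by exact_mod_cast Nat.lt_two_pow_self
    _ ≤ 2 ^ x := by
      rw [← Real.rpow_natCast]
      exact Real.rpow_le_rpow_of_exponent_le one_le_two (Nat.floor_le (by linarith))

theorem eventually_isLarge : ∀ᶠ n : ℕ in atTop, IsLarge n := by
  have h1 : ∀ᶠ x : ℝ in atTop, 5 + x ≤ 2 ^ √x := by
    have h2 : ∀ᶠ y : ℝ in atTop, 5 + y ^ 2 ≤ 2 ^ y := by
      have ho := isLittleO_pow_exp_pos_mul_atTop 2 (Real.log_pos one_lt_two)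
      filter_upwards [ho.bound (by norm_num : (0 : ℝ) < 1 / 2), eventually_ge_atTop 3]
        with y hy hy3
      rw [Real.norm_of_nonneg (by positivity), Real.norm_of_nonneg (Real.exp_pos _).le,
        ← Real.rpow_def_of_pos two_pos] at hy
      nlinarith
    filter_upwards [Real.tendsto_sqrt_atTop.eventually h2, eventually_ge_atTop 0] with x hx hx0
    rwa [Real.sq_sqrt hx0] at hx
  filter_upwards [eventually_ge_atTop 2, tendsto_doubleLog.eventually_ge_atTop 1,
    tendsto_doubleLog.eventually h1] with n hn hL hr
  refine ⟨hn, hL, ?_, hr⟩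
  have hn' : (2 : ℝ) ≤ n := by exact_mod_cast hn
  have hy : 1 ≤ Real.logb 2 n := by
    rw [Real.le_logb_iff_rpow_le one_lt_two (by linarith)]
    simpa using hn'
  exact (logb_two_le_self hy).trans (logb_two_le_self (by linarith))

namespace IsLarge

variable {n : ℕ}

theorem sqrt_le (h : IsLarge n) : √(doubleLog n) ≤ doubleLog n :=
  Real.sqrt_le_self_iff.2 (Or.inr h.one_le_doubleLog)

/-- Write `L` for `doubleLog n`. Since `4 * slack n ≤ 32 log₂ n = 2^(5 + L)`, the exponent of 2 is
at most `(5 + L) 2^(L - √L)`. The loss `2^(-√L)` absorbs `5 + L`, leaving `2^L = log₂ n`. -/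
theorem pow_roundCount_le (h : IsLarge n) : (4 * slack n) ^ 2 ^ roundCount n ≤ n := by
  have hn : (2 : ℝ) ≤ n := by exact_mod_cast h.two_le
  have hy : 1 ≤ Real.logb 2 n := by
    rw [Real.le_logb_iff_rpow_le one_lt_two (by linarith)]
    simpa using hn
  have hyL : (2 : ℝ) ^ doubleLog n = Real.logb 2 n :=
    Real.rpow_logb two_pos (by norm_num) (by linarith)
  have hL := h.one_le_doubleLog
  have hbase : (4 * slack n : ℝ) ≤ 2 ^ (5 + doubleLog n) := by
    rw [Real.rpow_add two_pos, hyL]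
    have := Real.natLog_le_logb n 2
    have h32 : (2 : ℝ) ^ (5 : ℝ) = 32 := by norm_num
    rw [h32]
    unfold slack
    push_cast at this ⊢
    linarith
  have hexp : (2 : ℝ) ^ roundCount n ≤ 2 ^ (doubleLog n - √(doubleLog n)) := by
    rw [← Real.rpow_natCast]
    exact Real.rpow_le_rpow_of_exponent_le one_le_two (Nat.floor_le (by linarith [h.sqrt_le]))
  have hprod : (5 + doubleLog n) * 2 ^ roundCount n ≤ Real.logb 2 n := by
    calc (5 + doubleLog n) * 2 ^ roundCount n
        ≤ 2 ^ √(doubleLog n) * 2 ^ (doubleLog n - √(doubleLog n)) :=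
          mul_le_mul h.add_le_rpow hexp (by positivity) (by positivity)
      _ = Real.logb 2 n := by rw [← Real.rpow_add two_pos, ← hyL]; ring_nf
  have : ((4 * slack n : ℝ)) ^ 2 ^ roundCount n ≤ n := by
    calc ((4 * slack n : ℝ)) ^ 2 ^ roundCount n
        ≤ (2 ^ (5 + doubleLog n)) ^ 2 ^ roundCount n := by gcongr
      _ = 2 ^ ((5 + doubleLog n) * 2 ^ roundCount n) := by
          rw [Real.rpow_mul two_pos.le, ← Real.rpow_natCast]
          push_cast
          rfl
      _ ≤ 2 ^ Real.logb 2 n := Real.rpow_le_rpow_of_exponent_le one_le_two hprod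
      _ = n := Real.rpow_logb two_pos (by norm_num) (by linarith)
  exact_mod_cast this

/-- The factor 3 in `slack` gives `2^(-slack n) ≤ n^(-3)`; the at most `n` rounds cost one power of
`n`. -/
theorem roundCount_mul_le (h : IsLarge n) :
    (roundCount n : ENNReal) * (2 ^ slack n)⁻¹ ≤ ENNReal.ofReal (1 / (n : ℝ) ^ 2) := by
  have hn : (2 : ℝ) ≤ n := by exact_mod_cast h.two_le
  have hT : (roundCount n : ℝ) ≤ n :=
    (Nat.floor_le (by linarith [h.sqrt_le])).trans
      (by linarith [h.doubleLog_le, Real.sqrt_nonneg (doubleLog n)])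
  have hs : (n : ℝ) ^ 3 ≤ 2 ^ slack n := by
    rw [slack, mul_comm, pow_mul]
    have : n ≤ 2 ^ (Nat.log 2 n + 1) := (Nat.lt_pow_succ_log_self one_lt_two n).le
    gcongr
    exact_mod_cast this
  have e : (roundCount n : ENNReal) * (2 ^ slack n)⁻¹ =
      ENNReal.ofReal (roundCount n * (2 ^ slack n)⁻¹) := by
    rw [ENNReal.ofReal_mul (by positivity), ENNReal.ofReal_natCast,
      ENNReal.ofReal_inv_of_pos (by positivity), ENNReal.ofReal_pow (by norm_num),
      ENNReal.ofReal_ofNat]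
  rw [e]
  refine ENNReal.ofReal_le_ofReal ?_
  rw [← div_eq_mul_inv, div_le_div_iff₀ (by positivity) (by positivity), one_mul]
  calc (roundCount n : ℝ) * n ^ 2 ≤ (n : ℝ) * (n : ℝ) ^ 2 := by gcongr
    _ = (n : ℝ) ^ 3 := by ring
    _ ≤ _ := hs

end IsLarge

/-! ### Lower bounds for the propagation times. -/

/-- The runs in which too many vertices are blue after `roundCount n` rounds. -/
def fastRuns {n : ℕ} (G : SimpleGraph (Fin n)) (v : Fin n) :
    Set (ℕ → Fin n × Fin n → unitInterval) :=
  {U | (4 * slack n) ^ 2 ^ roundCount n < 4 * (blue G {v} U (roundCount n)).ncard}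

theorem runMeasure_fastRuns_le {n : ℕ} (h : IsLarge n) (G : SimpleGraph (Fin n)) (v : Fin n) :
    runMeasure (Fin n) (fastRuns G v) ≤ ENNReal.ofReal (1 / (n : ℝ) ^ 2) :=
  (runMeasure_lt_ncard_blue_le G v (by unfold slack; omega) _).trans h.roundCount_mul_le

theorem roundCount_lt_propTime {n : ℕ} (h : IsLarge n) {G : SimpleGraph (Fin n)} {v : Fin n}
    {U : ℕ → Fin n × Fin n → unitInterval} (hU : U ∉ fastRuns G v) :
    ((roundCount n + 1 : ℕ) : ℕ∞) ≤ propTime G {v} U := by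
  refine lt_propTime G {v} U fun huniv => hU ?_
  have := h.pow_roundCount_le
  have := h.two_le
  simp only [fastRuns, Set.mem_ofPred_eq, huniv, Set.ncard_univ, Nat.card_eq_fintype_card,
    Fintype.card_fin]
  omega

/-- The relative error in the lower bound. -/
noncomputable def relError (n : ℕ) : ℝ := -(√(doubleLog n))⁻¹

theorem tendsto_relError : Tendsto relError atTop (𝓝 0) := by
  have := (tendsto_inv_atTop_zero.comp (Real.tendsto_sqrt_atTop.comp tendsto_doubleLog)).neg
  rw [neg_zero] at this
  exact this

theorem coe_le_of_roundCount_lt {n : ℕ} (h : IsLarge n) {N : ℕ∞}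
    (hN : ((roundCount n + 1 : ℕ) : ℕ∞) ≤ N) :
    (((1 + relError n) * Real.logb 2 (Real.logb 2 (n : ℝ)) : ℝ) : EReal) ≤
      ((N : ENNReal) : EReal) := by
  have hL := h.one_le_doubleLog
  -- The left side equals `L - √L`; the extra round in `roundCount n + 1` makes up for the floor.
  have h1 : (1 + relError n) * doubleLog n ≤ ((roundCount n + 1 : ℕ) : ℝ) := by
    have h2 : (√(doubleLog n))⁻¹ * doubleLog n = √(doubleLog n) := by
      rw [inv_mul_eq_div, Real.div_sqrt]
    have h3 := (Nat.lt_floor_add_one (doubleLog n - √(doubleLog n))).le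
    push_cast
    unfold relError roundCount
    linarith
  calc _ ≤ ((((roundCount n + 1 : ℕ) : ℝ)) : EReal) := EReal.coe_le_coe h1
    _ = ((((roundCount n + 1 : ℕ) : ℕ∞) : ENNReal) : EReal) := by
      rw [ENat.toENNReal_coe, ← ENNReal.ofReal_natCast,
        EReal.coe_ennreal_ofReal, max_eq_left (by positivity)]
    _ ≤ _ := EReal.coe_ennreal_le_coe_ennreal_iff.2 (by exact_mod_cast hN)

theorem one_sub_le_oneRunMeasure {n : ℕ} (h : IsLarge n) (p : unitInterval) (v : Fin n) :
    1 - 1 / (n : ℝ) ^ 2 ≤ (oneRunMeasure n p).real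
      {x | (((1 + relError n) * Real.logb 2 (Real.logb 2 (n : ℝ)) : ℝ) : EReal) ≤
        ((propTime x.1 {v} x.2 : ENNReal) : EReal)} := by
  refine one_sub_le_measureReal_of_compl _ (by positivity) ?_
  have := measurableSingletonClass_simpleGraph (V := Fin n)
  refine prod_measure_le_of_forall_section _ _ fun G => ?_
  refine (measure_mono fun U hU => ?_).trans (runMeasure_fastRuns_le h G v)
  by_contra hcon
  exact hU (coe_le_of_roundCount_lt h (roundCount_lt_propTime h hcon))

theorem one_sub_le_allRunsMeasure {n : ℕ} (h : IsLarge n) (p : unitInterval) :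
    1 - 1 / (n : ℝ) ≤ (allRunsMeasure n p).real
      {x | (((1 + relError n) * Real.logb 2 (Real.logb 2 (n : ℝ)) : ℝ) : EReal) ≤
        ((graphPropTime x.1 x.2 : ENNReal) : EReal)} := by
  refine one_sub_le_measureReal_of_compl _ (by positivity) ?_
  have := measurableSingletonClass_simpleGraph (V := Fin n)
  refine prod_measure_le_of_forall_section _ _ fun G => ?_
  have hsub : {W | (G, W) ∈ {x : SimpleGraph (Fin n) × (Fin n → ℕ → Fin n × Fin n → unitInterval) |
      (((1 + relError n) * Real.logb 2 (Real.logb 2 (n : ℝ)) : ℝ) : EReal) ≤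
        ((graphPropTime x.1 x.2 : ENNReal) : EReal)}ᶜ} ⊆
      ⋃ v : Fin n, (fun W => W v) ⁻¹' fastRuns G v := by
    intro W hW
    by_contra hcon
    simp only [Set.mem_iUnion, Set.mem_preimage, not_exists] at hcon
    exact hW (coe_le_of_roundCount_lt h (le_iInf fun v => roundCount_lt_propTime h (hcon v)))
  calc _ ≤ ∑ v : Fin n, Measure.pi (fun _ : Fin n => runMeasure (Fin n))
          ((fun W => W v) ⁻¹' fastRuns G v) :=
        (measure_mono hsub).trans (measure_iUnion_fintype_le _ _)
    _ ≤ ∑ _v : Fin n, ENNReal.ofReal (1 / (n : ℝ) ^ 2) := by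
        refine Finset.sum_le_sum fun v _ => ?_
        -- This inequality for the pushforward needs no measurability of `fastRuns G v`.
        refine (Measure.le_map_apply (measurable_pi_apply v).aemeasurable _).trans ?_
        have hmap := (measurePreserving_eval (fun _ : Fin n => runMeasure (Fin n)) v).map_eq
        rw [show Function.eval v = fun W : Fin n → ℕ → Fin n × Fin n → unitInterval => W v
          from rfl] at hmap
        rw [hmap]
        exact runMeasure_fastRuns_le h G v
    _ = ENNReal.ofReal (1 / (n : ℝ)) := by
        have hn : (n : ℝ) ≠ 0 := by
          have := h.two_le
          positivity
        rw [Finset.sum_const, Finset.card_univ, Fintype.card_fin, nsmul_eq_mul,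
          ← ENNReal.ofReal_natCast, ← ENNReal.ofReal_mul (by positivity)]
        congr 1
        field_simp

end ProbZeroForcing

theorem theorem4p1 (p : ℕ → unitInterval)
    (hp : ∀ᶠ n : ℕ in atTop, 1 / Real.log (n : ℝ) ^ 2 ≤ (p n : ℝ)) :
    ∃ δ : ℕ → ℝ, Tendsto δ atTop (𝓝 0) ∧
      (∃ η : ℕ → ℝ, Asymptotics.IsLittleO atTop η (fun n : ℕ => ((n : ℝ))⁻¹) ∧
        ∀ (n : ℕ) (v : Fin n),
          1 - η n ≤ (ProbZeroForcing.oneRunMeasure n (p n)).real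
            {x | (((1 + δ n) * Real.logb 2 (Real.logb 2 (n : ℝ)) : ℝ) : EReal) ≤
              ((ProbZeroForcing.propTime x.1 {v} x.2 : ENNReal) : EReal)}) ∧
      Tendsto (fun n : ℕ => (ProbZeroForcing.allRunsMeasure n (p n)).real
          {x | (((1 + δ n) * Real.logb 2 (Real.logb 2 (n : ℝ)) : ℝ) : EReal) ≤
            ((ProbZeroForcing.graphPropTime x.1 x.2 : ENNReal) : EReal)})
        atTop (𝓝 1) := by
  classical
  refine ⟨ProbZeroForcing.relError, ProbZeroForcing.tendsto_relError,
    -- The value 1 makes the bound trivial for the remaining `n`, as the claim is for all `n`.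
    ⟨fun n => if ProbZeroForcing.IsLarge n then 1 / (n : ℝ) ^ 2 else 1, ?_, fun n v => ?_⟩, ?_⟩
  · have h1 : (fun n : ℕ => 1 / (n : ℝ) ^ 2) =o[atTop] fun n : ℕ => ((n : ℝ))⁻¹ := by
      refine (Asymptotics.isLittleO_iff_tendsto' ?_).2 ?_
      · filter_upwards [eventually_ge_atTop 1] with n hn h0
        have : (n : ℝ)⁻¹ ≠ 0 := by positivity
        exact absurd h0 this
      · refine tendsto_one_div_atTop_nhds_zero_nat.congr' ?_
        filter_upwards [eventually_ge_atTop 1] with n hn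
        have : (n : ℝ) ≠ 0 := by positivity
        field_simp
    refine h1.congr' ?_ EventuallyEq.rfl
    filter_upwards [ProbZeroForcing.eventually_isLarge] with n hn
    simp [hn]
  · by_cases h : ProbZeroForcing.IsLarge n
    · simpa only [h, if_true] using ProbZeroForcing.one_sub_le_oneRunMeasure h (p n) v
    · simp only [h, if_false, sub_self]
      exact measureReal_nonneg
  · have hlim : Tendsto (fun n : ℕ => 1 - 1 / (n : ℝ)) atTop (𝓝 1) := by
      simpa using tendsto_one_div_atTop_nhds_zero_nat.const_sub (1 : ℝ)
    refine tendsto_of_tendsto_of_tendsto_of_le_of_le' hlim tendsto_const_nhds ?_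
      (Eventually.of_forall fun n => measureReal_le_one)
    filter_upwards [ProbZeroForcing.eventually_isLarge] with n hn
    exact ProbZeroForcing.one_sub_le_allRunsMeasure hn (p n)
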